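/- For $x>0$ let $\Gamma(x)=\int_0^\infty t^{x-1}e^{-t}\,dt$ and $\psi(x)=\Gamma'(x)/\Gamma(x)$, let $\gamma=\lim_{n\to\infty}\bigl(\sum_{k=1}^n \tfrac1k-\log n\bigr)$ be the Euler–Mascheroni constant, and for $a\in(0,1/2]$ let $R(a)=-2\gamma-\psi(a)-\psi(1-a)$ be the Ramanujan constant function. For $a\in(0,1/2]$ and $r\in(0,1)$ put $r'=\sqrt{1-r^2}$ and $$\mathcal K_a(r)=\frac{\pi}{2}F(a,1-a;1;r^2),\qquad F(a,b;c;x)=\sum_{n=0}^{\infty}\frac{(a)_n(b)_n}{(c)_n}\frac{x^n}{n!}\quad(-1<x<1),$$ where $(a)_n=a(a+1)\cdots(a+n-1)$ and $(a)_0=1$. **Theorem 1.1.** Let $a\in(0,1/2]$ and let $\alpha,\beta$ be real numbers (which may depend on $a$). Then the double inequality $$1+\alpha r'^2<\frac{\mathcal K_a(r)}{\sin(\pi a)\,\log\bigl(e^{R(a)/2}/r'\bigr)}<1+\beta r'^2$$ holds for all $r\in(0,1)$ if and only if $$\alpha\le\frac{\pi}{R(a)\sin(\pi a)}-1\quad\text{and}\quad\beta\ge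 a(1-a).$$ -/

import Mathlib

open Real

/-- The real digamma function `Ψ(x) = Γ'(x) / Γ(x)`. -/
noncomputable def realDigamma (x : ℝ) : ℝ := deriv Real.Gamma x / Real.Gamma x

/-- The Ramanujan constant function `R(x) = -2γ - Ψ(x) - Ψ(1 - x)`. -/
noncomputable def ramanujanR (x : ℝ) : ℝ :=
  -2 * Real.eulerMascheroniConstant - realDigamma x - realDigamma (1 - x)

/-- The generalized elliptic integral of the first kind,
`K_a(r) = (π / 2) F(a, 1 - a; 1; r ^ 2)`, with `F` the Gaussian hypergeometric function. -/
noncomputable def ellipticKGen (a r : ℝ) : ℝ :=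
  Real.pi / 2 * ordinaryHypergeometric a (1 - a) (1 : ℝ) (r ^ 2)

open Filter Topology

/-! Put `z = r²`, `c = a(1-a)`, `R = ramanujanR a`, `b_n = kCoeff a n`. By the reflection formula
the quotient is `kSeries a z / (R - log (1 - z))`, so everything rests on the sign of `D_m(z) =
kSeries a z - (R - log (1 - z)) * (1 + m * (1 - z))`, whose Taylor coefficients `d_n` are `diffCoeff
a m`. For every `m` they sum to `0` (`hasSum_diffCoeff`), because `∑ (b_n - 1/(n+1)) = R`
(`hasSum_kCoeff_sub`, from Gauss's summation at third parameter `1 + ε` as `ε → 0`).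

Upper bound, `m = c`: `d_n ≥ 0` for `n ≥ 1`, hence `-D_c(z) = ∑ d_n (1 - z^n) > 0` (`kSeries_lt`).
Lower bound, `m = b_0/R - 1`: here `d_0 = 0` and `d_1 > 0`, and the later coefficients change sign
at most once, from plus to minus. If this happens at `N`, then `D_m(z) = ∑ d_n (z^n - z^N) > 0`
(`lt_kSeries`). Sharpness: `α` is forced by `z → 0`. `β` is forced by `z → 1`, where `D_c(z) ≥ -C(1
- z)` while `-log (1 - z)` is unbounded. -/

/-! ### Digamma function and rational bounds for `ramanujanR`. -/

theorem differentiableAt_realGamma {x : ℝ} (hx : 0 < x) : DifferentiableAt ℝ Real.Gamma x :=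
  Real.differentiableAt_Gamma fun m ↦ ((neg_nonpos.mpr m.cast_nonneg).trans_lt hx).ne'

theorem realDigamma_add_one {x : ℝ} (hx : 0 < x) :
    realDigamma (x + 1) = realDigamma x + 1 / x := by
  have h1 : HasDerivAt (fun y ↦ Real.Gamma (y + 1)) (deriv Real.Gamma (x + 1)) x :=
    (differentiableAt_realGamma (by linarith : 0 < x + 1)).hasDerivAt.comp_add_const x 1
  have h2 : HasDerivAt (fun y ↦ y * Real.Gamma y) (1 * Real.Gamma x + x * deriv Real.Gamma x) x :=
    (hasDerivAt_id x).mul (differentiableAt_realGamma hx).hasDerivAt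
  have h3 : (fun y ↦ Real.Gamma (y + 1)) =ᶠ[𝓝 x] fun y ↦ y * Real.Gamma y := by
    filter_upwards [lt_mem_nhds hx] with y hy
    exact Real.Gamma_add_one hy.ne'
  have h4 := (h1.congr_of_eventuallyEq h3.symm).unique h2
  have hG := (Real.Gamma_pos_of_pos hx).ne'
  have hx' := hx.ne'
  rw [realDigamma, realDigamma, h4, Real.Gamma_add_one hx']
  field_simp
  ring

theorem realDigamma_one : realDigamma 1 = -Real.eulerMascheroniConstant := by
  rw [realDigamma, Real.eulerMascheroniConstant_eq_neg_deriv, Real.Gamma_one]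
  ring

theorem monotoneOn_realDigamma : MonotoneOn realDigamma (Set.Ioi 0) := by
  have hd : ∀ x ∈ Set.Ioi (0 : ℝ), DifferentiableAt ℝ (log ∘ Real.Gamma) x := fun x hx ↦
    (differentiableAt_realGamma hx).log (Real.Gamma_pos_of_pos hx).ne'
  refine (Real.convexOn_log_Gamma.monotoneOn_deriv hd).congr fun x hx ↦ ?_
  exact deriv.log (differentiableAt_realGamma hx) (Real.Gamma_pos_of_pos hx).ne'

theorem realDigamma_add_nat {x : ℝ} (hx : 0 < x) (N : ℕ) :
    realDigamma (x + N) = realDigamma x + ∑ k ∈ Finset.range N, 1 / (x + k) := by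
  induction N with
  | zero => simp
  | succ N ih =>
    rw [Finset.sum_range_succ, ← add_assoc, ← ih, Nat.cast_succ, ← add_assoc,
      realDigamma_add_one (by positivity)]

/-- The terms of the series expansion of `ramanujanR`. -/
noncomputable def ramanujanTerm (c : ℝ) (n : ℕ) : ℝ :=
  (n + 1 - 2 * c) / ((n + 1) * (n ^ 2 + n + c))

theorem ramanujanTerm_eq {a : ℝ} (ha : 0 < a) (ha1 : a < 1) (n : ℕ) :
    1 / (a + n) + 1 / (1 - a + n) - 2 * (1 / (1 + n)) = ramanujanTerm (a * (1 - a)) n := by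
  have h1 : (0 : ℝ) < a + n := by positivity
  have h2 : (0 : ℝ) < 1 - a + n := by have := n.cast_nonneg (α := ℝ); linarith
  have h3 : (n : ℝ) ^ 2 + n + a * (1 - a) = (a + n) * (1 - a + n) := by ring
  rw [ramanujanTerm, h3]
  have h4 : (0 : ℝ) < 1 + n := by positivity
  have h5 : (n : ℝ) + 1 = 1 + n := by ring
  rw [h5]
  field_simp
  ring

/-- Shift all three digamma values by `N`. Monotonicity of digamma then traps the remainder between
`0` and `2 / N`, which gives the next two lemmas. -/
theorem ramanujanR_eq_sum_add {a : ℝ} (ha : 0 < a) (ha1 : a < 1) (N : ℕ) :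
    ramanujanR a = ∑ n ∈ Finset.range N, ramanujanTerm (a * (1 - a)) n +
      (2 * realDigamma (1 + N) - realDigamma (a + N) - realDigamma (1 - a + N)) := by
  simp_rw [← ramanujanTerm_eq ha ha1]
  rw [Finset.sum_sub_distrib, Finset.sum_add_distrib, ← Finset.mul_sum, realDigamma_add_nat one_pos,
    realDigamma_add_nat ha, realDigamma_add_nat (by linarith : 0 < 1 - a), ramanujanR,
    realDigamma_one]
  ring

theorem sum_ramanujanTerm_le {a : ℝ} (ha : 0 < a) (ha1 : a < 1) (N : ℕ) :
    ∑ n ∈ Finset.range N, ramanujanTerm (a * (1 - a)) n ≤ ramanujanR a := by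
  rw [ramanujanR_eq_sum_add ha ha1 N]
  have hN := N.cast_nonneg (α := ℝ)
  have h1 := monotoneOn_realDigamma (a := a + N) (b := 1 + N) (by simp; linarith) (by simp; linarith)
    (by linarith)
  have h2 := monotoneOn_realDigamma (a := 1 - a + N) (b := 1 + N) (by simp; linarith)
    (by simp; linarith) (by linarith)
  linarith

theorem ramanujanR_le_sum_add {a : ℝ} (ha : 0 < a) (ha1 : a < 1) (N : ℕ) (hN : 1 ≤ N) :
    ramanujanR a ≤ ∑ n ∈ Finset.range N, ramanujanTerm (a * (1 - a)) n + 2 / N := by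
  rw [ramanujanR_eq_sum_add ha ha1 N]
  have hN : (1 : ℝ) ≤ N := by exact_mod_cast hN
  have h1 := monotoneOn_realDigamma (a := N) (b := a + N) (by simp; linarith) (by simp; linarith)
    (by linarith)
  have h2 := monotoneOn_realDigamma (a := N) (b := 1 - a + N) (by simp; linarith)
    (by simp; linarith) (by linarith)
  have h3 := realDigamma_add_one (x := N) (by linarith)
  rw [add_comm (1 : ℝ) N, h3]
  have : 2 / (N : ℝ) = 2 * (1 / N) := by ring
  linarith

theorem ramanujanTerm_le {c : ℝ} (hc : 0 < c) (n : ℕ) :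
    ramanujanTerm c n ≤ 1 / (n + c) - 1 / ((n + 1 : ℕ) + c) := by
  have hn := n.cast_nonneg (α := ℝ)
  rw [ramanujanTerm]
  push_cast
  rw [div_sub_div _ _ (by positivity) (by positivity), div_le_div_iff₀ (by positivity)
    (by positivity)]
  have h : 0 ≤ 3 * c ^ 2 * n + c ^ 2 + 2 * c ^ 3 := by positivity
  nlinarith [h]

theorem le_ramanujanTerm {c : ℝ} (hc : 0 < c) (hc1 : c ≤ 1 / 4) (n : ℕ) :
    1 / ((n : ℝ) + 1 / 2) - 1 / ((n + 1 : ℕ) + 1 / 2) ≤ ramanujanTerm c n := by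
  have hn := n.cast_nonneg (α := ℝ)
  rw [ramanujanTerm]
  push_cast
  rw [div_sub_div _ _ (by positivity) (by positivity), div_le_div_iff₀ (by positivity)
    (by positivity)]
  have h1 : 0 ≤ (1 - 2 * c) * (n : ℝ) ^ 2 := mul_nonneg (by linarith) (by positivity)
  have h2 : 0 ≤ (1 / 4 - c) * (n : ℝ) := mul_nonneg (by linarith) (by positivity)
  nlinarith [h1, h2]

theorem inv_sub_le_ramanujanR {a : ℝ} (ha : 0 < a) (ha1 : a < 1) :
    1 / (a * (1 - a)) - 4 / 3 ≤ ramanujanR a := by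
  set c := a * (1 - a) with hc
  have hc0 : 0 < c := mul_pos ha (by linarith)
  have hc1 : c ≤ 1 / 4 := by nlinarith [sq_nonneg (a - 1 / 2)]
  -- The term `n = 0` is kept exactly, as `1/c - 2`; the telescoping minorant of the others starts
  -- at `1/(3/2)`, and `-2 + 2/3 = -4/3`.
  have key : ∀ N : ℕ, 1 / c - 4 / 3 - 1 / ((N + 1 : ℕ) + 1 / 2 : ℝ) ≤ ramanujanR a := by
    intro N
    refine le_trans ?_ (sum_ramanujanTerm_le ha ha1 (N + 1))
    rw [Finset.sum_range_succ']
    have h0 : ramanujanTerm c 0 = 1 / c - 2 := by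
      rw [ramanujanTerm]; field_simp; push_cast; ring
    have h1 := Finset.sum_le_sum (s := Finset.range N) fun n _ ↦ le_ramanujanTerm hc0 hc1 (n + 1)
    rw [Finset.sum_range_sub' (fun n : ℕ ↦ 1 / (((n + 1 : ℕ) : ℝ) + 1 / 2))] at h1
    rw [h0]
    norm_num at h1 ⊢
    linarith
  have hlim : Tendsto (fun N : ℕ ↦ 1 / c - 4 / 3 - 1 / ((N + 1 : ℕ) + 1 / 2 : ℝ)) atTop
      (𝓝 (1 / c - 4 / 3 - 0)) := by
    refine tendsto_const_nhds.sub ?_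
    refine tendsto_const_nhds.div_atTop (tendsto_atTop_add_const_right _ _ ?_)
    exact tendsto_natCast_atTop_atTop.comp (tendsto_add_atTop_nat 1)
  rw [sub_zero] at hlim
  exact le_of_tendsto hlim (Eventually.of_forall key)

theorem ramanujanR_le {a : ℝ} (ha : 0 < a) (ha1 : a < 1) :
    ramanujanR a ≤ (1 + a * (1 - a)) * (2 - 3 * (a * (1 - a))) /
      (a * (1 - a) * (2 + a * (1 - a))) := by
  set c := a * (1 - a) with hc
  have hc0 : 0 < c := mul_pos ha (by linarith)
  -- The terms `n = 0, 1` are kept exactly and the telescoping majorant contributes at most `1/(2 +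
  -- c)`.
  have key : ∀ N : ℕ, ramanujanR a ≤ (1 + c) * (2 - 3 * c) / (c * (2 + c)) +
      2 / ((N + 2 : ℕ) : ℝ) := by
    intro N
    refine (ramanujanR_le_sum_add ha ha1 (N + 2) (by omega)).trans ?_
    gcongr
    rw [Finset.sum_range_succ', Finset.sum_range_succ']
    have h0 : ramanujanTerm c 0 + ramanujanTerm c 1 + 1 / (2 + c) =
        (1 + c) * (2 - 3 * c) / (c * (2 + c)) := by
      rw [ramanujanTerm, ramanujanTerm]
      push_cast
      have : (1 : ℝ) ^ 2 + 1 + c ≠ 0 := by positivity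
      field_simp
      ring
    have h1 := Finset.sum_le_sum (s := Finset.range N) fun n _ ↦ ramanujanTerm_le hc0 (n + 1 + 1)
    rw [Finset.sum_range_sub' (fun n : ℕ ↦ 1 / (((n + 1 + 1 : ℕ) : ℝ) + c))] at h1
    have h2 : 0 ≤ 1 / (((N + 1 + 1 : ℕ) : ℝ) + c) := by positivity
    have h3 : (((0 + 1 + 1 : ℕ) : ℝ) + c) = 2 + c := by norm_num
    rw [h3] at h1
    rw [← h0, zero_add]
    linarith
  have hlim : Tendsto (fun N : ℕ ↦ (1 + c) * (2 - 3 * c) / (c * (2 + c)) +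
      2 / ((N + 2 : ℕ) : ℝ)) atTop (𝓝 ((1 + c) * (2 - 3 * c) / (c * (2 + c)) + 0)) := by
    refine tendsto_const_nhds.add (tendsto_const_nhds.div_atTop ?_)
    exact tendsto_natCast_atTop_atTop.comp (tendsto_add_atTop_nat 2)
  rw [add_zero] at hlim
  exact ge_of_tendsto hlim (Eventually.of_forall key)

/-! ### Asymptotics and two-sided bounds for the Taylor coefficients. -/

/-- The Taylor coefficients of `z ↦ Γ(a) Γ(1 - a) F(a, 1 - a; 1; z)` at the origin. -/
noncomputable def kCoeff (a : ℝ) (n : ℕ) : ℝ :=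
  Real.Gamma a * Real.Gamma (1 - a) * ∏ k ∈ Finset.range n, ((a + k) * (1 - a + k)) / (k + 1) ^ 2

theorem kCoeff_zero (a : ℝ) : kCoeff a 0 = Real.Gamma a * Real.Gamma (1 - a) := by
  simp [kCoeff]

theorem kCoeff_succ (a : ℝ) (n : ℕ) :
    kCoeff a (n + 1) = kCoeff a n * ((n ^ 2 + n + a * (1 - a)) / (n + 1) ^ 2) := by
  rw [kCoeff, Finset.prod_range_succ, kCoeff, ← mul_assoc]
  congr 2
  ring

theorem kCoeff_pos {a : ℝ} (ha : 0 < a) (ha1 : a < 1) (n : ℕ) : 0 < kCoeff a n := by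
  have h1 : 0 < 1 - a := by linarith
  refine mul_pos (mul_pos (Real.Gamma_pos_of_pos ha) (Real.Gamma_pos_of_pos h1)) ?_
  exact Finset.prod_pos fun k _ ↦ by positivity

/-- An exact finite identity; Euler's limit for Gamma turns it into `n * kCoeff a n → 1`. -/
theorem kCoeff_mul_gammaSeq {a : ℝ} (ha : 0 < a) (ha1 : a < 1) {n : ℕ} (hn : 1 ≤ n) :
    kCoeff a (n + 1) * ((n + 1) ^ 2 / n) * (Real.GammaSeq a n * Real.GammaSeq (1 - a) n) =
      Real.Gamma a * Real.Gamma (1 - a) := by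
  have hn0 : (0 : ℝ) < n := by exact_mod_cast hn
  have h1 : 0 < 1 - a := by linarith
  have hp1 : (0 : ℝ) < ∏ j ∈ Finset.range (n + 1), (a + j) :=
    Finset.prod_pos fun k _ ↦ by positivity
  have hp2 : (0 : ℝ) < ∏ j ∈ Finset.range (n + 1), (1 - a + j) :=
    Finset.prod_pos fun k _ ↦ by positivity
  have hf : (∏ k ∈ Finset.range (n + 1), ((k : ℝ) + 1)) = (n + 1) * n.factorial := by
    have := Finset.prod_range_add_one_eq_factorial (n + 1)
    rw [Nat.factorial_succ] at this
    exact_mod_cast this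
  have hpow : (n : ℝ) ^ a * (n : ℝ) ^ (1 - a) = n := by
    rw [← Real.rpow_add hn0]; simp
  rw [kCoeff, Real.GammaSeq, Real.GammaSeq, Finset.prod_div_distrib, Finset.prod_mul_distrib,
    Finset.prod_pow, hf]
  have hfac : (0 : ℝ) < n.factorial := by positivity
  have : (n : ℝ) ^ a * n.factorial / (∏ j ∈ Finset.range (n + 1), (a + (j : ℝ))) *
      ((n : ℝ) ^ (1 - a) * n.factorial / (∏ j ∈ Finset.range (n + 1), (1 - a + (j : ℝ)))) =
      n * (n.factorial : ℝ) ^ 2 / ((∏ j ∈ Finset.range (n + 1), (a + (j : ℝ))) *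
        (∏ j ∈ Finset.range (n + 1), (1 - a + (j : ℝ)))) := by
    rw [div_mul_div_comm, mul_mul_mul_comm, hpow, sq]
  rw [this]
  field_simp

theorem tendsto_mul_kCoeff {a : ℝ} (ha : 0 < a) (ha1 : a < 1) :
    Tendsto (fun n : ℕ ↦ n * kCoeff a n) atTop (𝓝 1) := by
  have h1 : 0 < 1 - a := by linarith
  have hB : Real.Gamma a * Real.Gamma (1 - a) ≠ 0 :=
    (mul_pos (Real.Gamma_pos_of_pos ha) (Real.Gamma_pos_of_pos h1)).ne'
  have hG := (Real.GammaSeq_tendsto_Gamma a).mul (Real.GammaSeq_tendsto_Gamma (1 - a))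
  have h2 : Tendsto (fun n : ℕ ↦ kCoeff a (n + 1) * (((n : ℝ) + 1) ^ 2 / n)) atTop (𝓝 1) := by
    have h3 := (tendsto_const_nhds (x := Real.Gamma a * Real.Gamma (1 - a))).div hG hB
    rw [div_self hB] at h3
    refine h3.congr' ?_
    filter_upwards [eventually_ge_atTop 1, hG.eventually_ne hB] with n hn hne
    simp only [Pi.div_apply]
    rw [← kCoeff_mul_gammaSeq ha ha1 hn, mul_div_cancel_right₀ _ hne]
  have h4 : Tendsto (fun n : ℕ ↦ (n : ℝ) / (n + 1)) atTop (𝓝 1) :=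
    tendsto_natCast_div_add_atTop 1
  rw [← tendsto_add_atTop_iff_nat 1]
  have h5 := h2.mul h4
  rw [one_mul] at h5
  refine h5.congr' ?_
  filter_upwards [eventually_ge_atTop 1] with n hn
  have hn0 : (0 : ℝ) < n := by exact_mod_cast hn
  push_cast
  field_simp

theorem tendsto_kCoeff {a : ℝ} (ha : 0 < a) (ha1 : a < 1) :
    Tendsto (kCoeff a) atTop (𝓝 0) := by
  rw [← tendsto_add_atTop_iff_nat 1]
  have h := ((tendsto_add_atTop_iff_nat 1).2 (tendsto_mul_kCoeff ha ha1)).mul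
    (tendsto_one_div_add_atTop_nhds_zero_nat (𝕜 := ℝ))
  rw [mul_zero] at h
  refine h.congr fun n ↦ ?_
  push_cast
  field_simp

/-- With `c = a(1-a)`, the sequence `(n + c) b_n` increases to its limit `1`. -/
theorem kCoeff_le {a : ℝ} (ha : 0 < a) (ha1 : a < 1) (n : ℕ) :
    kCoeff a n ≤ 1 / (n + a * (1 - a)) := by
  have hc : 0 < a * (1 - a) := mul_pos ha (by linarith)
  have hmono : Monotone fun n : ℕ ↦ (n + a * (1 - a)) * kCoeff a n := by
    refine monotone_nat_of_le_succ fun n ↦ ?_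
    have hb := kCoeff_pos ha ha1 n
    rw [kCoeff_succ]
    set c := a * (1 - a)
    have : (((n + 1 : ℕ) : ℝ) + c) * (kCoeff a n * ((n ^ 2 + n + c) / (n + 1) ^ 2)) -
        (n + c) * kCoeff a n = kCoeff a n * (c ^ 2 / (n + 1) ^ 2) := by
      push_cast
      field_simp
      ring
    have h2 : 0 ≤ kCoeff a n * (c ^ 2 / ((n : ℝ) + 1) ^ 2) := by positivity
    linarith
  have hlim : Tendsto (fun n : ℕ ↦ (n + a * (1 - a)) * kCoeff a n) atTop (𝓝 1) := by
    have := (tendsto_mul_kCoeff ha ha1).add ((tendsto_kCoeff ha ha1).const_mul (a * (1 - a)))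
    simp only [mul_zero, add_zero] at this
    exact this.congr fun n ↦ by ring
  have := hmono.ge_of_tendsto hlim n
  rw [le_div_iff₀ (by positivity)]
  linarith

/-- For `n ≥ 1` the sequence `n² b_n / (n - c)` decreases to its limit `1`. -/
theorem le_kCoeff {a : ℝ} (ha : 0 < a) (ha1 : a < 1) {n : ℕ} (hn : 1 ≤ n) :
    (n - a * (1 - a)) / n ^ 2 ≤ kCoeff a n := by
  have hc : 0 < a * (1 - a) := mul_pos ha (by linarith)
  have hc1 : a * (1 - a) ≤ 1 / 4 := by nlinarith [sq_nonneg (a - 1 / 2)]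
  have hanti : Antitone fun n : ℕ ↦
      ((n + 1 : ℕ) : ℝ) ^ 2 * kCoeff a (n + 1) / ((n + 1 : ℕ) - a * (1 - a)) := by
    refine antitone_nat_of_succ_le fun n ↦ ?_
    have hb := kCoeff_pos ha ha1 (n + 1)
    rw [kCoeff_succ a (n + 1)]
    set c := a * (1 - a)
    have hn0 := n.cast_nonneg (α := ℝ)
    have h1 : 0 < (n : ℝ) + 1 - c := by linarith
    have h2 : 0 < (n : ℝ) + 1 + 1 - c := by linarith
    push_cast
    rw [div_le_div_iff₀ h2 h1]
    have : ((n : ℝ) + 1) ^ 2 * kCoeff a (n + 1) * (n + 1 + 1 - c) - (n + 1 + 1) ^ 2 *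
        (kCoeff a (n + 1) * (((n + 1) ^ 2 + (n + 1) + c) / (n + 1 + 1) ^ 2)) * (n + 1 - c)
        = kCoeff a (n + 1) * c ^ 2 := by
      field_simp
      ring
    have h3 : 0 ≤ kCoeff a (n + 1) * c ^ 2 := by positivity
    linarith
  have hlim : Tendsto (fun n : ℕ ↦
      ((n + 1 : ℕ) : ℝ) ^ 2 * kCoeff a (n + 1) / ((n + 1 : ℕ) - a * (1 - a))) atTop (𝓝 1) := by
    have h1 := (tendsto_mul_kCoeff ha ha1).mul
      (tendsto_natCast_div_add_atTop (𝕜 := ℝ) (-(a * (1 - a))))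
    rw [mul_one] at h1
    refine ((tendsto_add_atTop_iff_nat 1).2 h1).congr fun n ↦ ?_
    ring
  obtain ⟨m, rfl⟩ : ∃ m, n = m + 1 := ⟨n - 1, by omega⟩
  have := hanti.le_of_tendsto hlim m
  have h1 : 0 < ((m + 1 : ℕ) : ℝ) - a * (1 - a) := by
    push_cast
    have := m.cast_nonneg (α := ℝ)
    linarith
  rw [le_div_iff₀ h1] at this
  rw [div_le_iff₀ (by positivity)]
  linarith

theorem one_div_succ_le_kCoeff {a : ℝ} (ha : 0 < a) (ha1 : a < 1) (n : ℕ) :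
    1 / ((n : ℝ) + 1) ≤ kCoeff a n := by
  have hc : 0 < a * (1 - a) := mul_pos ha (by linarith)
  have hc1 : a * (1 - a) ≤ 1 / 4 := by nlinarith [sq_nonneg (a - 1 / 2)]
  rcases Nat.eq_zero_or_pos n with rfl | hn
  · have h := le_kCoeff ha ha1 le_rfl
    rw [kCoeff_succ] at h
    norm_num at h ⊢
    by_contra! h1
    nlinarith [mul_lt_mul_of_pos_right h1 hc]
  · refine le_trans ?_ (le_kCoeff ha ha1 hn)
    have hn1 : (1 : ℝ) ≤ n := by exact_mod_cast hn
    rw [div_le_div_iff₀ (by positivity) (by positivity)]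
    nlinarith

/-! ### Gauss summation and the regularized value at `z = 1`. -/

/-- The ratio `n! / (1 + ε)ₙ`. -/
noncomputable def pochRatio (ε : ℝ) (n : ℕ) : ℝ :=
  ∏ k ∈ Finset.range n, ((k : ℝ) + 1) / (k + 1 + ε)

theorem pochRatio_zero (ε : ℝ) : pochRatio ε 0 = 1 := by simp [pochRatio]

theorem pochRatio_succ (ε : ℝ) (n : ℕ) :
    pochRatio ε (n + 1) = pochRatio ε n * ((n + 1) / (n + 1 + ε)) :=
  Finset.prod_range_succ _ _

theorem pochRatio_pos {ε : ℝ} (hε : 0 ≤ ε) (n : ℕ) : 0 < pochRatio ε n :=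
  Finset.prod_pos fun k _ ↦ by positivity

theorem pochRatio_le_of_le {ε δ : ℝ} (hε : 0 ≤ ε) (h : ε ≤ δ) (n : ℕ) :
    pochRatio δ n ≤ pochRatio ε n := by
  refine Finset.prod_le_prod (fun k _ ↦ ?_) fun k _ ↦ ?_
  · have : 0 ≤ δ := hε.trans h
    positivity
  · gcongr

theorem pochRatio_param_zero (n : ℕ) : pochRatio 0 n = 1 :=
  Finset.prod_eq_one fun k _ ↦ by rw [add_zero]; exact div_self (by positivity)

theorem pochRatio_le_one {ε : ℝ} (hε : 0 ≤ ε) (n : ℕ) : pochRatio ε n ≤ 1 :=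
  (pochRatio_le_of_le le_rfl hε n).trans_eq (pochRatio_param_zero n)

theorem pochRatio_add_one {ε : ℝ} (hε : 0 ≤ ε) (n : ℕ) :
    pochRatio (ε + 1) n = pochRatio ε n * ((1 + ε) / (n + 1 + ε)) := by
  induction n with
  | zero => rw [pochRatio_zero, pochRatio_zero]; field_simp; push_cast; ring
  | succ n ih =>
    rw [pochRatio_succ, ih, pochRatio_succ]
    push_cast
    have h1 : (n : ℝ) + 1 + (ε + 1) = n + 1 + 1 + ε := by ring
    rw [h1]
    field_simp

theorem tendsto_pochRatio {ε : ℝ} (hε : 0 < ε) : Tendsto (pochRatio ε) atTop (𝓝 0) := by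
  -- The product is at most `1 / (1 + ε H_n)`, with `H_n` the divergent harmonic sum.
  have key : ∀ n : ℕ, pochRatio ε n *
      (1 + ε * ∑ k ∈ Finset.range n, 1 / ((k : ℝ) + 1)) ≤ 1 := by
    intro n
    induction n with
    | zero => simp [pochRatio_zero]
    | succ n ih =>
      refine le_trans ?_ ih
      have hp := pochRatio_pos hε.le n
      have hs : (0 : ℝ) ≤ ∑ k ∈ Finset.range n, 1 / ((k : ℝ) + 1) :=
        Finset.sum_nonneg fun k _ ↦ by positivity
      rw [pochRatio_succ, Finset.sum_range_succ, mul_assoc]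
      refine mul_le_mul_of_nonneg_left ?_ hp.le
      rw [div_mul_eq_mul_div, div_le_iff₀ (by positivity)]
      set s := ∑ k ∈ Finset.range n, 1 / ((k : ℝ) + 1)
      have : ((n : ℝ) + 1) * (1 + ε * (s + 1 / (n + 1))) = (n + 1) * (1 + ε * s) + ε := by
        field_simp
        ring
      rw [this]
      nlinarith [mul_nonneg (mul_nonneg hε.le hε.le) hs]
  have hlim : Tendsto (fun n : ℕ ↦ 1 / (1 + ε * ∑ k ∈ Finset.range n, 1 / ((k : ℝ) + 1)))
      atTop (𝓝 0) := by
    refine tendsto_const_nhds.div_atTop (tendsto_atTop_add_const_left _ _ ?_)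
    exact Real.tendsto_sum_range_one_div_nat_succ_atTop.const_mul_atTop hε
  refine squeeze_zero (fun n ↦ (pochRatio_pos hε.le n).le) (fun n ↦ ?_) hlim
  have hs : (0 : ℝ) ≤ ∑ k ∈ Finset.range n, 1 / ((k : ℝ) + 1) :=
    Finset.sum_nonneg fun k _ ↦ by positivity
  rw [le_div_iff₀ (by positivity)]
  exact key n

theorem hasSum_pochRatio_div {ε : ℝ} (hε : 0 < ε) :
    HasSum (fun n : ℕ ↦ pochRatio ε n / (n + 1 + ε)) (1 / ε) := by
  rw [hasSum_iff_tendsto_nat_of_nonneg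
    (fun n ↦ div_nonneg (pochRatio_pos hε.le n).le (by positivity))]
  have h : ∀ n : ℕ, ∑ k ∈ Finset.range n, pochRatio ε k / (k + 1 + ε) =
      (1 - pochRatio ε n) / ε := by
    intro n
    have : ∀ k : ℕ, pochRatio ε k / (k + 1 + ε) =
        (pochRatio ε k - pochRatio ε (k + 1)) / ε := by
      intro k
      rw [pochRatio_succ]
      field_simp
      ring
    simp_rw [this]
    rw [← Finset.sum_div, Finset.sum_range_sub', pochRatio_zero]
  simp_rw [h]
  have := ((tendsto_pochRatio hε).const_sub 1).div_const ε
  rwa [sub_zero] at this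

theorem summable_kCoeff_mul_pochRatio {a ε : ℝ} (ha : 0 < a) (ha1 : a < 1) (hε : 0 < ε) :
    Summable fun n ↦ kCoeff a n * pochRatio ε n := by
  have hc : 0 < a * (1 - a) := mul_pos ha (by linarith)
  have hc1 : a * (1 - a) ≤ 1 / 4 := by nlinarith [sq_nonneg (a - 1 / 2)]
  refine Summable.of_nonneg_of_le
    (fun n ↦ mul_nonneg (kCoeff_pos ha ha1 n).le (pochRatio_pos hε.le n).le) (fun n ↦ ?_)
    ((hasSum_pochRatio_div hε).summable.mul_left ((1 + ε) / (a * (1 - a))))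
  set c := a * (1 - a) with hcdef
  have h1 : kCoeff a n ≤ (1 + ε) / c * (1 / (n + 1 + ε)) := by
    refine (kCoeff_le ha ha1 n).trans ?_
    rw [← hcdef, div_mul_div_comm, div_le_div_iff₀ (by positivity) (by positivity)]
    have hn := n.cast_nonneg (α := ℝ)
    nlinarith [mul_nonneg hε.le hn, mul_nonneg hε.le hc.le, mul_nonneg hc.le hn]
  calc kCoeff a n * pochRatio ε n ≤ (1 + ε) / c * (1 / (n + 1 + ε)) * pochRatio ε n :=
        mul_le_mul_of_nonneg_right h1 (pochRatio_pos hε.le n).le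
    _ = (1 + ε) / c * (pochRatio ε n / (n + 1 + ε)) := by ring

/-- The value `Γ(a) Γ(1 - a) F(a, 1 - a; 1 + ε; 1)`. -/
noncomputable def gaussValue (a ε : ℝ) : ℝ := ∑' n, kCoeff a n * pochRatio ε n

/-- The termwise difference of the two sides telescopes. The boundary term `(1 + ε) n b_n pochRatio
ε n` vanishes at `n = 0` and tends to `0`, since `n b_n → 1` and `pochRatio ε n → 0`. -/
theorem gaussValue_contiguous {a ε : ℝ} (ha : 0 < a) (ha1 : a < 1) (hε : 0 < ε) :
    ε * (1 + ε) * gaussValue a ε = (ε + a) * (ε + 1 - a) * gaussValue a (ε + 1) := by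
  have hs1 := (summable_kCoeff_mul_pochRatio ha ha1 hε).hasSum.mul_left (ε * (1 + ε))
  have hs2 := (summable_kCoeff_mul_pochRatio ha ha1 (by linarith : 0 < ε + 1)).hasSum.mul_left
    ((ε + a) * (ε + 1 - a))
  have hs3 := (hs1.sub hs2).tendsto_sum_nat
  have hterm : ∀ n : ℕ, ε * (1 + ε) * (kCoeff a n * pochRatio ε n) -
      (ε + a) * (ε + 1 - a) * (kCoeff a n * pochRatio (ε + 1) n) =
      (1 + ε) * (n * kCoeff a n * pochRatio ε n) -
        (1 + ε) * ((n + 1 : ℕ) * kCoeff a (n + 1) * pochRatio ε (n + 1)) := by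
    intro n
    rw [pochRatio_add_one hε.le, kCoeff_succ, pochRatio_succ]
    push_cast
    field_simp
    ring
  simp_rw [hterm] at hs3
  simp_rw [Finset.sum_range_sub' (fun n : ℕ ↦ (1 + ε) * (n * kCoeff a n * pochRatio ε n))] at hs3
  have hlim := ((tendsto_mul_kCoeff ha ha1).mul (tendsto_pochRatio hε)).const_mul (1 + ε)
  have h := tendsto_nhds_unique hs3 (hlim.const_sub _)
  simp only [CharP.cast_eq_zero, zero_mul, mul_zero, sub_zero] at h
  exact sub_eq_zero.1 h

theorem gaussValue_eq_mul_prod {a ε : ℝ} (ha : 0 < a) (ha1 : a < 1) (hε : 0 < ε) (N : ℕ) :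
    gaussValue a ε = gaussValue a (ε + N) *
      ∏ k ∈ Finset.range N, ((ε + a + k) * (ε + 1 - a + k)) / ((ε + k) * (ε + 1 + k)) := by
  induction N with
  | zero => simp
  | succ N ih =>
    have h := gaussValue_contiguous ha ha1 (by positivity : 0 < ε + N)
    rw [ih, Finset.prod_range_succ]
    have h1 : gaussValue a (ε + N) = gaussValue a (ε + (N + 1 : ℕ)) *
        (((ε + a + N) * (ε + 1 - a + N)) / ((ε + N) * (ε + 1 + N))) := by
      have h2 : 0 < ε + N := by positivity
      have h3 : 0 < ε + 1 + N := by positivity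
      rw [mul_div_assoc', eq_div_iff (by positivity)]
      push_cast
      rw [← add_assoc]
      linear_combination h
    rw [h1]
    ring

theorem tendsto_gaussValue_add_nat {a ε : ℝ} (ha : 0 < a) (ha1 : a < 1) (hε : 0 < ε) :
    Tendsto (fun N : ℕ ↦ gaussValue a (ε + N)) atTop (𝓝 (kCoeff a 0)) := by
  have h0 : kCoeff a 0 = ∑' n, if n = 0 then kCoeff a 0 else 0 := by
    rw [tsum_ite_eq]
  rw [h0]
  refine tendsto_tsum_of_dominated_convergence (summable_kCoeff_mul_pochRatio ha ha1 hε)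
    (fun n ↦ ?_) (Eventually.of_forall fun N n ↦ ?_)
  · rcases n with _ | n
    · simp [pochRatio_zero]
    · simp only [Nat.add_eq_zero_iff, one_ne_zero, and_false, if_false]
      rw [← mul_zero (kCoeff a (n + 1))]
      refine Tendsto.const_mul _ ?_
      have hlim : Tendsto (fun N : ℕ ↦ ((n : ℝ) + 1) / (n + 1 + (ε + N))) atTop (𝓝 0) :=
        tendsto_const_nhds.div_atTop (tendsto_atTop_add_const_left _ _
          (tendsto_atTop_add_const_left _ _ tendsto_natCast_atTop_atTop))
      refine squeeze_zero (fun N ↦ (pochRatio_pos (by positivity) _).le) (fun N ↦ ?_) hlim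
      rw [pochRatio_succ]
      exact mul_le_of_le_one_left (by positivity) (pochRatio_le_one (by positivity) n)
  · have hp := pochRatio_pos (by positivity : 0 ≤ ε + N) n
    have hb := kCoeff_pos ha ha1 n
    rw [Real.norm_of_nonneg (by positivity)]
    have := pochRatio_le_of_le hε.le (by simp : ε ≤ ε + N) n
    gcongr

theorem tendsto_prod_gauss {a ε : ℝ} (ha : 0 < a) (ha1 : a < 1) (hε : 0 < ε) :
    Tendsto (fun N : ℕ ↦ ∏ k ∈ Finset.range (N + 1),
      ((ε + a + k) * (ε + 1 - a + k)) / ((ε + k) * (ε + 1 + k))) atTop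
      (𝓝 (Real.Gamma ε * Real.Gamma (ε + 1) /
        (Real.Gamma (ε + a) * Real.Gamma (ε + 1 - a)))) := by
  have ha2 : 0 < ε + 1 - a := by linarith
  have hne : Real.Gamma (ε + a) * Real.Gamma (ε + 1 - a) ≠ 0 :=
    (mul_pos (Real.Gamma_pos_of_pos (by positivity)) (Real.Gamma_pos_of_pos ha2)).ne'
  refine (((Real.GammaSeq_tendsto_Gamma ε).mul (Real.GammaSeq_tendsto_Gamma (ε + 1))).div
    ((Real.GammaSeq_tendsto_Gamma (ε + a)).mul
      (Real.GammaSeq_tendsto_Gamma (ε + 1 - a))) hne).congr' ?_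
  filter_upwards [eventually_ge_atTop 1] with N hN
  have hN0 : (0 : ℝ) < N := by exact_mod_cast hN
  have hprod : ∀ s : ℝ, 0 < s → (0 : ℝ) < ∏ j ∈ Finset.range (N + 1), (s + j) :=
    fun s hs ↦ Finset.prod_pos fun k _ ↦ by positivity
  have h1 := hprod ε hε
  have h2 := hprod (ε + 1) (by positivity)
  have h3 := hprod (ε + a) (by positivity)
  have h4 := hprod (ε + 1 - a) ha2
  have hpow : (N : ℝ) ^ ε * (N : ℝ) ^ (ε + 1) = (N : ℝ) ^ (ε + a) * (N : ℝ) ^ (ε + 1 - a) := by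
    rw [← Real.rpow_add hN0, ← Real.rpow_add hN0]
    congr 1
    ring
  have hp3 : (0 : ℝ) < (N : ℝ) ^ (ε + a) := by positivity
  have hp4 : (0 : ℝ) < (N : ℝ) ^ (ε + 1 - a) := by positivity
  have hfac : (0 : ℝ) < N.factorial := by positivity
  simp only [Pi.div_apply, Real.GammaSeq]
  rw [Finset.prod_div_distrib, Finset.prod_mul_distrib, Finset.prod_mul_distrib,
    div_mul_div_comm, div_mul_div_comm, mul_mul_mul_comm, hpow,
    mul_mul_mul_comm ((N : ℝ) ^ (ε + a))]
  field_simp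

/-- Gauss's theorem: iterate the contiguous relation. As the parameter grows only the term `n = 0`
survives, and the product tends to a Gamma quotient. -/
theorem mul_gaussValue {a ε : ℝ} (ha : 0 < a) (ha1 : a < 1) (hε : 0 < ε) :
    ε * gaussValue a ε = Real.Gamma a * Real.Gamma (1 - a) * Real.Gamma (1 + ε) ^ 2 /
      (Real.Gamma (a + ε) * Real.Gamma (1 - a + ε)) := by
  have h := ((tendsto_add_atTop_iff_nat 1).2 (tendsto_gaussValue_add_nat ha ha1 hε)).mul
    (tendsto_prod_gauss ha ha1 hε)
  have h2 := tendsto_nhds_unique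
    (h.congr fun N ↦ (gaussValue_eq_mul_prod ha ha1 hε (N + 1)).symm) tendsto_const_nhds
  rw [← h2, kCoeff_zero, add_comm 1 ε, add_comm a ε, show 1 - a + ε = ε + 1 - a by ring,
    Real.Gamma_add_one hε.ne']
  ring

theorem hasDerivAt_gauss {a : ℝ} (ha : 0 < a) (ha1 : a < 1) :
    HasDerivAt (fun ε ↦ Real.Gamma a * Real.Gamma (1 - a) * Real.Gamma (1 + ε) ^ 2 /
      (Real.Gamma (a + ε) * Real.Gamma (1 - a + ε))) (ramanujanR a) 0 := by
  have ha2 : 0 < 1 - a := by linarith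
  have hd : ∀ s : ℝ, 0 < s →
      HasDerivAt (fun ε ↦ Real.Gamma (s + ε)) (realDigamma s * Real.Gamma s) 0 := by
    intro s hs
    have h1 : HasDerivAt Real.Gamma (realDigamma s * Real.Gamma s) (s + 0) := by
      rw [add_zero, realDigamma, div_mul_cancel₀ _ (Real.Gamma_pos_of_pos hs).ne']
      exact (differentiableAt_realGamma hs).hasDerivAt
    exact h1.comp_const_add s 0
  have hG1 := Real.Gamma_pos_of_pos ha
  have hG2 := Real.Gamma_pos_of_pos ha2
  have h := ((((hd 1 one_pos).pow 2).const_mul (Real.Gamma a * Real.Gamma (1 - a))).div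
    ((hd a ha).mul (hd (1 - a) ha2)) (by simp [hG1.ne', hG2.ne']))
  refine h.congr_deriv ?_
  simp only [add_zero, Real.Gamma_one, realDigamma_one, ramanujanR, Pi.mul_apply, Pi.pow_apply]
  field_simp
  norm_num
  ring

/-- The regularized value at `1` of `Γ(a) Γ(1 - a) F(a, 1 - a; 1; z)`. -/
theorem hasSum_kCoeff_sub {a : ℝ} (ha : 0 < a) (ha1 : a < 1) :
    HasSum (fun n : ℕ ↦ kCoeff a n - 1 / (n + 1)) (ramanujanR a) := by
  have hc : 0 < a * (1 - a) := mul_pos ha (by linarith)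
  have hc1 : a * (1 - a) ≤ 1 / 4 := by nlinarith [sq_nonneg (a - 1 / 2)]
  -- Each of the two series diverges at `ε = 0`; their difference is `O(1/n²)` uniformly in `ε`,
  -- which permits passing to the limit termwise.
  have hbound : ∀ (ε : ℝ), 0 ≤ ε → ε ≤ 1 → ∀ n : ℕ,
      ‖kCoeff a n * pochRatio ε n - pochRatio ε n / (n + 1 + ε)‖ ≤
        2 / (a * (1 - a)) * (1 / ((n + 1 : ℕ) : ℝ) ^ 2) := by
    intro ε hε hε1 n
    have hp := pochRatio_pos hε n
    have h1 : 1 / ((n : ℝ) + 1 + ε) ≤ 1 / (n + 1) :=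
      one_div_le_one_div_of_le (by positivity) (by linarith)
    have h2 := one_div_succ_le_kCoeff ha ha1 n
    have h3 : 0 ≤ kCoeff a n - 1 / (n + 1 + ε) := by linarith
    have h4 : 1 / ((n : ℝ) + 2) ≤ 1 / (n + 1 + ε) :=
      one_div_le_one_div_of_le (by positivity) (by linarith)
    have h5 := kCoeff_le ha ha1 n
    have h6 : kCoeff a n * pochRatio ε n - pochRatio ε n / (n + 1 + ε) =
        (kCoeff a n - 1 / (n + 1 + ε)) * pochRatio ε n := by ring
    rw [h6, Real.norm_of_nonneg (by positivity)]
    refine (mul_le_of_le_one_right h3 (pochRatio_le_one hε n)).trans ?_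
    set c := a * (1 - a)
    have h7 : 1 / ((n : ℝ) + c) - 1 / (n + 2) ≤ 2 / c * (1 / ((n + 1 : ℕ) : ℝ) ^ 2) := by
      push_cast
      rw [div_sub_div _ _ (by positivity) (by positivity), div_mul_div_comm,
        div_le_div_iff₀ (by positivity) (by positivity)]
      have hn := n.cast_nonneg (α := ℝ)
      have e1 : c * (n + 1) ≤ n + c := by nlinarith
      have e2 : (c * (n + 1)) * (n + 1) ≤ (n + c) * (n + 2) := by gcongr; linarith
      have e3 : 0 ≤ (c * ((n : ℝ) + 1)) * (n + 1) := by positivity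
      nlinarith [mul_nonneg hc.le e3]
    linarith
  have hsumm : Summable fun n : ℕ ↦ 2 / (a * (1 - a)) * (1 / ((n + 1 : ℕ) : ℝ) ^ 2) :=
    ((summable_nat_add_iff 1).2 (Real.summable_one_div_nat_pow.2 one_lt_two)).mul_left _
  have hlim : Tendsto (fun ε ↦ ∑' n : ℕ,
      (kCoeff a n * pochRatio ε n - pochRatio ε n / (n + 1 + ε))) (𝓝[>] 0)
      (𝓝 (∑' n : ℕ, (kCoeff a n - 1 / (n + 1)))) := by
    refine tendsto_tsum_of_dominated_convergence hsumm (fun n ↦ ?_) ?_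
    · have hcont : ContinuousAt (fun ε ↦ kCoeff a n * pochRatio ε n -
          pochRatio ε n / (n + 1 + ε)) 0 := by
        have hq : ContinuousAt (fun ε ↦ pochRatio ε n) 0 := by
          unfold pochRatio
          refine tendsto_finsetProd _ fun k _ ↦ ?_
          refine ContinuousAt.div (by fun_prop) (by fun_prop) ?_
          positivity
        refine (hq.const_mul _).sub (hq.div (by fun_prop) ?_)
        positivity
      have := hcont.tendsto
      simp only [pochRatio_param_zero, mul_one, add_zero] at this
      exact this.mono_left nhdsWithin_le_nhds
    · filter_upwards [Ioo_mem_nhdsGT (zero_lt_one' ℝ)] with ε hε n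
      exact hbound ε hε.1.le hε.2.le n
  have hder := (hasDerivAt_iff_tendsto_slope_zero.1 (hasDerivAt_gauss ha ha1)).mono_left
    (nhdsGT_le_nhdsNE 0)
  have hG1 := Real.Gamma_pos_of_pos ha
  have hG2 := Real.Gamma_pos_of_pos (by linarith : 0 < 1 - a)
  -- For `ε > 0` the sum is `gaussValue a ε - 1/ε`, the difference quotient at `0` of `ε *
  -- gaussValue a ε`, whose Gamma form equals `1` there and has derivative `ramanujanR a`.
  have heq : ∑' n : ℕ, (kCoeff a n - 1 / (n + 1)) = ramanujanR a := by
    refine tendsto_nhds_unique hlim (hder.congr' ?_)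
    filter_upwards [self_mem_nhdsWithin] with ε hε
    have hε : 0 < ε := hε
    have h := ((summable_kCoeff_mul_pochRatio ha ha1 hε).hasSum.sub
      (hasSum_pochRatio_div hε)).tsum_eq
    rw [h, zero_add, ← mul_gaussValue ha ha1 hε, gaussValue]
    simp only [add_zero, Real.Gamma_one, smul_eq_mul]
    field_simp
  rw [← heq]
  refine (Summable.of_norm_bounded hsumm fun n ↦ ?_).hasSum
  simpa [pochRatio_param_zero] using hbound 0 le_rfl zero_le_one n

/-! ### Taylor coefficients of the difference function. -/

theorem hasSum_telescope_one_div {j : ℝ} (hj : 0 < j) :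
    HasSum (fun n : ℕ ↦ 1 / ((n : ℝ) + j) - 1 / (n + 1 + j)) (1 / j) := by
  rw [hasSum_iff_tendsto_nat_of_nonneg (fun n ↦ sub_nonneg.2
    (one_div_le_one_div_of_le (by positivity) (by linarith)))]
  have h : ∀ N : ℕ, ∑ n ∈ Finset.range N, (1 / ((n : ℝ) + j) - 1 / (n + 1 + j)) =
      1 / j - 1 / (N + j) := by
    intro N
    have := Finset.sum_range_sub' (fun n : ℕ ↦ 1 / ((n : ℝ) + j)) N
    simpa using this
  simp_rw [h]
  have hlim : Tendsto (fun N : ℕ ↦ 1 / ((N : ℝ) + j)) atTop (𝓝 0) :=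
    tendsto_const_nhds.div_atTop (tendsto_atTop_add_const_right _ _ tendsto_natCast_atTop_atTop)
  simpa using hlim.const_sub (1 / j)

theorem pos_of_hasSum {f : ℕ → ℝ} {s : ℝ} (hf : ∀ n, 0 ≤ f n) (i : ℕ) (hi : 0 < f i)
    (h : HasSum f s) : 0 < s :=
  hasSum_lt hf hi hasSum_zero h

/-- Subtracting `z^N ∑ v n = 0` turns the terms into `v n (z^n - z^N)`, in which both factors change
sign at `N`. -/
theorem sum_mul_pow_pos_of_sign_change {v : ℕ → ℝ} (hv : HasSum v 0) {N : ℕ} (hN : 1 < N)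
    (hpos : ∀ n < N, 0 ≤ v n) (hneg : ∀ n, N ≤ n → v n ≤ 0) (h1 : 0 < v 1) {z S : ℝ}
    (hz : 0 < z) (hz1 : z < 1) (hS : HasSum (fun n ↦ v n * z ^ n) S) : 0 < S := by
  have h := hS.sub (hv.mul_right (z ^ N))
  rw [zero_mul, sub_zero] at h
  refine pos_of_hasSum (fun n ↦ ?_) 1 ?_ h
  · rw [← mul_sub]
    rcases lt_or_ge n N with hn | hn
    · exact mul_nonneg (hpos n hn) (sub_nonneg.2 (pow_le_pow_of_le_one hz.le hz1.le hn.le))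
    · exact mul_nonneg_of_nonpos_of_nonpos (hneg n hn)
        (sub_nonpos.2 (pow_le_pow_of_le_one hz.le hz1.le hn))
  · rw [← mul_sub]
    exact mul_pos h1 (sub_pos.2 (pow_lt_pow_right_of_lt_one₀ hz hz1 hN))

/-- The function `z ↦ Γ(a) Γ(1 - a) F(a, 1 - a; 1; z)` on the unit interval. -/
noncomputable def kSeries (a z : ℝ) : ℝ := ∑' n, kCoeff a n * z ^ n

/-- The Taylor coefficients at the origin of
`z ↦ kSeries a z - (ramanujanR a - log (1 - z)) * (1 + m * (1 - z))`. -/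
noncomputable def diffCoeff (a m : ℝ) : ℕ → ℝ
  | 0 => kCoeff a 0 - (1 + m) * ramanujanR a
  | 1 => kCoeff a 1 - (1 + m) + m * ramanujanR a
  | n + 2 => kCoeff a (n + 2) - (n + 1 - m) / ((n + 2) * (n + 1))

theorem hasSum_diffCoeff {a : ℝ} (ha : 0 < a) (ha1 : a < 1) (m : ℝ) :
    HasSum (diffCoeff a m) 0 := by
  rw [← hasSum_nat_add_iff' 2]
  have h1 := (hasSum_nat_add_iff' 2).2 (hasSum_kCoeff_sub ha ha1)
  have h2 := hasSum_telescope_one_div (one_pos : (0 : ℝ) < 1)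
  have h3 := hasSum_telescope_one_div (two_pos : (0 : ℝ) < 2)
  convert (h1.sub h3).add (h2.mul_left m) using 1
  · ext n
    simp only [diffCoeff]
    push_cast
    field_simp
    ring
  · simp only [Finset.sum_range_succ, Finset.sum_range_zero, diffCoeff]
    push_cast
    ring

theorem hasSum_kSeries {a z : ℝ} (ha : 0 < a) (ha1 : a < 1) (hz : 0 ≤ z) (hz1 : z < 1) :
    HasSum (fun n ↦ kCoeff a n * z ^ n) (kSeries a z) := by
  have hc : 0 < a * (1 - a) := mul_pos ha (by linarith)
  refine (Summable.of_nonneg_of_le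
    (fun n ↦ mul_nonneg (kCoeff_pos ha ha1 n).le (pow_nonneg hz n)) (fun n ↦ ?_)
    ((summable_geometric_of_lt_one hz hz1).mul_left (1 / (a * (1 - a))))).hasSum
  refine mul_le_mul_of_nonneg_right ((kCoeff_le ha ha1 n).trans ?_) (pow_nonneg hz n)
  exact one_div_le_one_div_of_le hc (by simp)

theorem hasSum_diffCoeff_mul_pow {a z : ℝ} (ha : 0 < a) (ha1 : a < 1) (m : ℝ) (hz : 0 < z)
    (hz1 : z < 1) :
    HasSum (fun n ↦ diffCoeff a m n * z ^ n)
      (kSeries a z - (ramanujanR a - log (1 - z)) * (1 + m * (1 - z))) := by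
  rw [← hasSum_nat_add_iff' 2]
  have h1 := (hasSum_nat_add_iff' 2).2 (hasSum_kSeries ha ha1 hz.le hz1)
  have h2 := Real.hasSum_pow_div_log_of_abs_lt_one (abs_lt.2 ⟨by linarith, hz1⟩)
  have h3 := (hasSum_nat_add_iff' 1).2 h2
  convert (h1.sub (h3.mul_left (1 + m))).add (h2.mul_left (m * z)) using 1
  · ext n
    simp only [diffCoeff]
    push_cast
    field_simp
    ring
  · simp only [Finset.sum_range_succ, Finset.sum_range_zero, diffCoeff]
    push_cast
    ring

theorem continuousOn_tsum_diffCoeff {a : ℝ} (ha : 0 < a) (ha1 : a < 1) (m : ℝ) :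
    ContinuousOn (fun z : ℝ ↦ ∑' n, diffCoeff a m n * z ^ n) (Set.Icc 0 1) := by
  refine continuousOn_tsum (fun n ↦ by fun_prop) (hasSum_diffCoeff ha ha1 m).summable.norm
    fun n z hz ↦ ?_
  rw [norm_mul, norm_pow, Real.norm_of_nonneg hz.1]
  exact mul_le_of_le_one_right (norm_nonneg _) (pow_le_one₀ hz.1 hz.2)

/-! ### Upper bound and its sharpness estimate. -/

theorem param_bounds {a : ℝ} (ha : 0 < a) (ha1 : a < 1) :
    0 < a * (1 - a) ∧ a * (1 - a) ≤ 1 / 4 :=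
  ⟨mul_pos ha (by linarith), by nlinarith [sq_nonneg (a - 1 / 2)]⟩

theorem le_mul_ramanujanR {a : ℝ} (ha : 0 < a) (ha1 : a < 1) :
    1 - 4 / 3 * (a * (1 - a)) ≤ a * (1 - a) * ramanujanR a := by
  have hc := (param_bounds ha ha1).1
  have h := mul_le_mul_of_nonneg_left (inv_sub_le_ramanujanR ha ha1) hc.le
  rw [mul_sub, mul_one_div_cancel hc.ne'] at h
  linarith

theorem ramanujanR_pos {a : ℝ} (ha : 0 < a) (ha1 : a < 1) : 0 < ramanujanR a := by
  obtain ⟨hc, hc1⟩ := param_bounds ha ha1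
  have h := le_mul_ramanujanR ha ha1
  exact pos_of_mul_pos_right (by linarith : 0 < a * (1 - a) * ramanujanR a) hc.le

theorem kCoeff_one (a : ℝ) : kCoeff a 1 = kCoeff a 0 * (a * (1 - a)) := by
  rw [kCoeff_succ]; norm_num

theorem diffCoeff_one_pos {a : ℝ} (ha : 0 < a) (ha1 : a < 1) :
    0 < diffCoeff a (a * (1 - a)) 1 := by
  obtain ⟨hc, hc1⟩ := param_bounds ha ha1
  have h := le_mul_ramanujanR ha ha1
  have h1 := le_kCoeff ha ha1 le_rfl
  norm_num at h1
  simp only [diffCoeff]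
  linarith

theorem diffCoeff_add_two_nonneg {a : ℝ} (ha : 0 < a) (ha1 : a < 1) (n : ℕ) :
    0 ≤ diffCoeff a (a * (1 - a)) (n + 2) := by
  obtain ⟨hc, hc1⟩ := param_bounds ha ha1
  have h1 := le_kCoeff ha ha1 (by omega : 1 ≤ n + 2)
  simp only [diffCoeff]
  refine sub_nonneg.2 (le_trans ?_ h1)
  push_cast
  rw [div_le_div_iff₀ (by positivity) (by positivity)]
  have hn := n.cast_nonneg (α := ℝ)
  nlinarith [mul_nonneg hc.le hn]

theorem kSeries_lt {a z : ℝ} (ha : 0 < a) (ha1 : a < 1) (hz : 0 < z) (hz1 : z < 1) :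
    kSeries a z < (ramanujanR a - log (1 - z)) * (1 + a * (1 - a) * (1 - z)) := by
  have h := (hasSum_diffCoeff ha ha1 (a * (1 - a))).sub
    (hasSum_diffCoeff_mul_pow ha ha1 (a * (1 - a)) hz hz1)
  have := pos_of_hasSum (fun n ↦ ?_) 1 ?_ h
  · linarith
  · rcases n with _ | _ | n
    · simp
    · have := diffCoeff_one_pos ha ha1
      simp only [zero_add, pow_one]
      nlinarith
    · have h1 := diffCoeff_add_two_nonneg ha ha1 n
      have h2 : z ^ (n + 2) ≤ 1 := pow_le_one₀ hz.le hz1.le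
      rw [← mul_one_sub]
      exact mul_nonneg h1 (by linarith)
  · have := diffCoeff_one_pos ha ha1
    rw [pow_one]
    nlinarith

/-- Bernoulli's inequality `1 - z^n ≤ n (1 - z)` allows `C = ∑ n d_n`, which converges because `d_n
= O(1/n³)` when `m = a(1-a)`. -/
theorem exists_le_kSeries {a : ℝ} (ha : 0 < a) (ha1 : a < 1) :
    ∃ C : ℝ, ∀ z : ℝ, 0 < z → z < 1 → (ramanujanR a - log (1 - z)) * (1 + a * (1 - a) * (1 - z)) -
      C * (1 - z) ≤ kSeries a z := by
  obtain ⟨hc, hc1⟩ := param_bounds ha ha1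
  have hsumm : Summable fun n : ℕ ↦ n * diffCoeff a (a * (1 - a)) n := by
    rw [← summable_nat_add_iff 2]
    have h2 : Summable fun n : ℕ ↦ 1 / ((n + 1 : ℕ) : ℝ) ^ 2 :=
      (summable_nat_add_iff 1).2 (Real.summable_one_div_nat_pow.2 one_lt_two)
    refine Summable.of_nonneg_of_le
      (fun n ↦ mul_nonneg (Nat.cast_nonneg _) (diffCoeff_add_two_nonneg ha ha1 n)) (fun n ↦ ?_) h2
    have h1 := kCoeff_le ha ha1 (n + 2)
    simp only [diffCoeff]
    set c := a * (1 - a)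
    have hn := n.cast_nonneg (α := ℝ)
    calc ((n + 2 : ℕ) : ℝ) * (kCoeff a (n + 2) - (n + 1 - c) / ((n + 2) * (n + 1)))
        ≤ ((n + 2 : ℕ) : ℝ) * (1 / ((n + 2 : ℕ) + c) - (n + 1 - c) / ((n + 2) * (n + 1))) := by
          gcongr
      _ = (c + c ^ 2) / ((n + 1) * (n + 2 + c)) := by
          push_cast
          field_simp
          ring
      _ ≤ 1 / ((n + 1 : ℕ) : ℝ) ^ 2 := by
          push_cast
          rw [sq ((n : ℝ) + 1)]
          exact div_le_div₀ zero_le_one (by nlinarith) (by positivity)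
            (mul_le_mul_of_nonneg_left (by linarith) (by positivity))
  refine ⟨∑' n : ℕ, n * diffCoeff a (a * (1 - a)) n, fun z hz hz1 ↦ ?_⟩
  have h := (hasSum_diffCoeff ha ha1 (a * (1 - a))).sub
    (hasSum_diffCoeff_mul_pow ha ha1 (a * (1 - a)) hz hz1)
  have := hasSum_le (fun n ↦ ?_) h (hsumm.hasSum.mul_right (1 - z))
  · linarith
  · have hB : 1 - z ^ n ≤ n * (1 - z) := by
      have := one_add_mul_le_pow (by linarith : -2 ≤ z - 1) n
      rw [add_sub_cancel] at this
      linarith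
    rcases n with _ | _ | n
    · simp
    · have := diffCoeff_one_pos ha ha1
      simp only [zero_add, pow_one]
      push_cast
      linarith
    · have h1 := diffCoeff_add_two_nonneg ha ha1 n
      rw [← mul_one_sub, mul_right_comm, mul_comm _ (diffCoeff _ _ _)]
      exact mul_le_mul_of_nonneg_left hB h1

/-! ### Lower bound. -/

/-- This is `d_1 > 0` for `m = b_0/R - 1`, multiplied by `R`. After scaling by `c²` the slack at the
endpoint `ρ` is only of order `c²` as `c → 0`. -/
theorem sq_ramanujanR_lt {a : ℝ} (ha : 0 < a) (ha1 : a < 1) :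
    ramanujanR a ^ 2 < kCoeff a 0 * ((1 + a * (1 - a)) * ramanujanR a - 1) := by
  obtain ⟨hc, hc1⟩ := param_bounds ha ha1
  have hlow := le_mul_ramanujanR ha ha1
  have hup := mul_le_mul_of_nonneg_left (ramanujanR_le ha ha1) hc.le
  have hB := le_kCoeff ha ha1 (by norm_num : 1 ≤ 3)
  rw [kCoeff_succ, kCoeff_succ, kCoeff_one] at hB
  set c := a * (1 - a)
  set R := ramanujanR a
  set B := kCoeff a 0
  norm_num at hB
  -- The bound `b_3 ≥ (3 - c)/9`, carried back to `b_1 = c B` by the recurrence.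
  have hB' : 4 * (3 - c) / ((6 + c) * (2 + c)) ≤ c * B := by
    rw [div_le_iff₀ (by positivity)]
    linarith
  set s := c * R with hs
  set ρ := (1 + c) * (2 - 3 * c) / (2 + c) with hρ
  have hup' : s ≤ ρ := by
    refine hup.trans_eq ?_
    rw [hρ]
    field_simp
  set β := 4 * (3 - c) / ((6 + c) * (2 + c)) with hβ
  have hρend : ρ ^ 2 < β * ((1 + c) * ρ - c) := by
    have : β * ((1 + c) * ρ - c) - ρ ^ 2 =
        c ^ 2 * (14 - 41 * c - 48 * c ^ 2 - 9 * c ^ 3) / ((6 + c) * (2 + c) ^ 2) := by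
      rw [hβ, hρ]
      field_simp
      ring
    have hpoly : 0 < 14 - 41 * c - 48 * c ^ 2 - 9 * c ^ 3 := by
      nlinarith [mul_nonneg hc.le (sub_nonneg.2 hc1), pow_pos hc 2,
        mul_nonneg (pow_pos hc 2).le (sub_nonneg.2 hc1)]
    have : 0 < c ^ 2 * (14 - 41 * c - 48 * c ^ 2 - 9 * c ^ 3) / ((6 + c) * (2 + c) ^ 2) := by
      positivity
    linarith
  have hβ1 : β ≤ 1 := by
    rw [hβ, div_le_one (by positivity)]
    nlinarith
  -- The product is `f ρ - f s` for `f x = x² - β((1 + c)x - c)`, so `f ρ < 0` passes down to `s`.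
  have hslope : 0 ≤ (ρ - s) * (s + ρ - β * (1 + c)) := by
    refine mul_nonneg (by linarith) ?_
    nlinarith
  have hpos : 0 < (1 + c) * s - c := by nlinarith
  have hmain : s ^ 2 < c * B * ((1 + c) * s - c) :=
    lt_of_lt_of_le (by nlinarith) (mul_le_mul_of_nonneg_right hB' hpos.le)
  have : c ^ 2 * R ^ 2 < c ^ 2 * (B * ((1 + c) * R - 1)) := by
    rw [hs] at hmain
    nlinarith
  exact lt_of_mul_lt_mul_left this (by positivity)

/-- This gives the single sign change. The scaling makes the subtracted part the affine `n + 1 - m`,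
so the increments do not depend on `m` and `kCoeff_le` makes them nonpositive. -/
theorem antitone_scaled_diffCoeff {a : ℝ} (ha : 0 < a) (ha1 : a < 1) (m : ℝ) :
    Antitone fun n : ℕ ↦ ((n : ℝ) + 2) * (n + 1) * diffCoeff a m (n + 2) := by
  obtain ⟨hc, hc1⟩ := param_bounds ha ha1
  refine antitone_nat_of_succ_le fun n ↦ ?_
  have hk := kCoeff_le ha ha1 (n + 2)
  simp only [diffCoeff]
  rw [kCoeff_succ a (n + 2)]
  set c := a * (1 - a)
  set b := kCoeff a (n + 2)
  push_cast at hk ⊢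
  have hn := n.cast_nonneg (α := ℝ)
  have h1 : b * ((n + 2) * (n + 3 + c)) ≤ n + 3 := by
    rw [le_div_iff₀ (by positivity)] at hk
    have hb : 0 < b := kCoeff_pos ha ha1 _
    have e : (((n : ℝ) + 2) * (n + 3 + c)) ≤ (n + 2 + c) * (n + 3) := by nlinarith
    calc b * (((n : ℝ) + 2) * (n + 3 + c)) ≤ b * ((n + 2 + c) * (n + 3)) := by gcongr
      _ = (b * (n + 2 + c)) * (n + 3) := by ring
      _ ≤ 1 * (n + 3) := by gcongr
      _ = n + 3 := one_mul _
  have h2 : ((n : ℝ) + 1 + 2) * (n + 1 + 1) * (b * (((n + 2) ^ 2 + (n + 2) + c) / (n + 2 + 1) ^ 2) -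
      (n + 1 + 1 - m) / ((n + 1 + 2) * (n + 1 + 1))) -
      (n + 2) * (n + 1) * (b - (n + 1 - m) / ((n + 2) * (n + 1))) =
      (b * ((n + 2) * (n + 3 + c)) - (n + 3)) / (n + 3) := by
    field_simp
    ring
  have h3 : (b * ((n + 2) * (n + 3 + c)) - (n + 3)) / ((n : ℝ) + 3) ≤ 0 :=
    div_nonpos_of_nonpos_of_nonneg (by linarith) (by positivity)
  linarith

theorem lt_kSeries {a z : ℝ} (ha : 0 < a) (ha1 : a < 1) (hz : 0 < z) (hz1 : z < 1) :
    (ramanujanR a - log (1 - z)) * (1 + (kCoeff a 0 / ramanujanR a - 1) * (1 - z)) <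
      kSeries a z := by
  have hR := ramanujanR_pos ha ha1
  set m := kCoeff a 0 / ramanujanR a - 1 with hm
  have hmR : (1 + m) * ramanujanR a = kCoeff a 0 := by
    rw [hm, add_sub_cancel, div_mul_cancel₀ _ hR.ne']
  have h0 : diffCoeff a m 0 = 0 := by simp only [diffCoeff]; linarith
  have h1 : 0 < diffCoeff a m 1 := by
    simp only [diffCoeff]
    rw [kCoeff_one]
    have h := sq_ramanujanR_lt ha ha1
    have : ramanujanR a * (kCoeff a 0 * (a * (1 - a)) - (1 + m) + m * ramanujanR a) =
        kCoeff a 0 * ((1 + a * (1 - a)) * ramanujanR a - 1) - ramanujanR a ^ 2 := by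
      linear_combination (ramanujanR a - 1) * hmR
    exact pos_of_mul_pos_right (by linarith) hR.le
  have hsum := hasSum_diffCoeff ha ha1 m
  -- Otherwise the coefficients, whose sum is `0`, would have a positive sum.
  have hex : ∃ n : ℕ, diffCoeff a m (n + 2) ≤ 0 := by
    by_contra! hall
    refine lt_irrefl _ (pos_of_hasSum (fun n ↦ ?_) 1 h1 hsum)
    rcases n with _ | _ | n
    · exact h0.ge
    · exact h1.le
    · exact (hall n).le
  classical
  have hfind := Nat.find_spec hex
  have := sum_mul_pow_pos_of_sign_change hsum (N := Nat.find hex + 2) (by omega) (fun n hn ↦ ?_)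
    (fun n hn ↦ ?_) h1 hz hz1 (hasSum_diffCoeff_mul_pow ha ha1 m hz hz1)
  · linarith
  · rcases n with _ | _ | n
    · exact h0.ge
    · exact h1.le
    · exact (not_le.1 (Nat.find_min hex (by omega : n < Nat.find hex))).le
  · obtain ⟨k, rfl⟩ : ∃ k, n = k + 2 := ⟨n - 2, by omega⟩
    have h := antitone_scaled_diffCoeff ha ha1 m (by omega : Nat.find hex ≤ k)
    have h2 : ((k : ℝ) + 2) * (k + 1) * diffCoeff a m (k + 2) ≤ 0 :=
      h.trans (mul_nonpos_of_nonneg_of_nonpos (by positivity) hfind)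
    exact nonpos_of_mul_nonpos_right h2 (by positivity)

/-! ### Reduction to `kSeries`, necessity of the constants, and the theorem. -/

theorem ellipticKGen_eq {a : ℝ} (ha : 0 < a) (ha1 : a < 1) (r : ℝ) :
    ellipticKGen a r = Real.sin (π * a) / 2 * kSeries a (r ^ 2) := by
  have hsin : 0 < Real.sin (π * a) :=
    Real.sin_pos_of_pos_of_lt_pi (by positivity) (by nlinarith [Real.pi_pos])
  have hcoeff : ∀ n : ℕ, kCoeff a n = π / Real.sin (π * a) *
      ((n.factorial : ℝ)⁻¹ * (ascPochhammer ℝ n).eval a * (ascPochhammer ℝ n).eval (1 - a) *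
        ((ascPochhammer ℝ n).eval 1)⁻¹) := by
    intro n
    induction n with
    | zero => simp [kCoeff_zero, Real.Gamma_mul_Gamma_one_sub]
    | succ n ih =>
      rw [kCoeff_succ, ih]
      simp only [ascPochhammer_succ_eval, ascPochhammer_eval_one, Nat.factorial_succ]
      push_cast
      have : (0 : ℝ) < n.factorial := by positivity
      field_simp
      ring
  rw [ellipticKGen, ordinaryHypergeometric_eq_tsum, kSeries]
  simp_rw [hcoeff, mul_assoc (π / Real.sin (π * a))]
  rw [tsum_mul_left]
  simp only [smul_eq_mul]
  field_simp

theorem ellipticKGen_ratio_eq {a r : ℝ} (ha : 0 < a) (ha1 : a < 1) (hr : r ∈ Set.Ioo (0 : ℝ) 1) :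
    ellipticKGen a r /
      (Real.sin (π * a) * Real.log (Real.exp (ramanujanR a / 2) / √(1 - r ^ 2))) =
      kSeries a (r ^ 2) / (ramanujanR a - log (1 - r ^ 2)) := by
  have hsin : 0 < Real.sin (π * a) :=
    Real.sin_pos_of_pos_of_lt_pi (by positivity) (by nlinarith [Real.pi_pos])
  have hx : 0 < 1 - r ^ 2 := by nlinarith [hr.1, hr.2]
  rw [ellipticKGen_eq ha ha1, Real.log_div (Real.exp_pos _).ne' (Real.sqrt_pos.2 hx).ne',
    Real.log_exp, Real.log_sqrt hx.le, ← sub_div, ← mul_div_assoc, div_mul_eq_mul_div,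
    div_div_div_cancel_right₀ two_ne_zero, mul_div_mul_left _ _ hsin.ne']

theorem ramanujanR_sub_log_pos {a z : ℝ} (ha : 0 < a) (ha1 : a < 1) (hz : 0 < z) (hz1 : z < 1) :
    0 < ramanujanR a - log (1 - z) := by
  have := ramanujanR_pos ha ha1
  have := Real.log_neg (by linarith : 0 < 1 - z) (by linarith)
  linarith

theorem le_of_forall_lt_kSeries {a α : ℝ} (ha : 0 < a) (ha1 : a < 1)
    (h : ∀ z : ℝ, 0 < z → z < 1 →
      (ramanujanR a - log (1 - z)) * (1 + α * (1 - z)) < kSeries a z) :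
    α ≤ kCoeff a 0 / ramanujanR a - 1 := by
  have hcont := ((continuousOn_tsum_diffCoeff ha ha1 α) 0 (by simp)).mono
    Set.Ioo_subset_Icc_self
  have hval : ∑' n, diffCoeff a α n * (0 : ℝ) ^ n = diffCoeff a α 0 := by
    rw [tsum_eq_single 0 fun n hn ↦ by rw [zero_pow hn, mul_zero]]
    simp
  simp only [ContinuousWithinAt, hval] at hcont
  have : (𝓝[Set.Ioo (0 : ℝ) 1] 0).NeBot := left_nhdsWithin_Ioo_neBot one_pos
  have h0 : 0 ≤ diffCoeff a α 0 := by
    refine ge_of_tendsto hcont ?_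
    filter_upwards [self_mem_nhdsWithin] with z hz
    rw [(hasSum_diffCoeff_mul_pow ha ha1 α hz.1 hz.2).tsum_eq]
    linarith [h z hz.1 hz.2]
  simp only [diffCoeff] at h0
  have : 1 + α ≤ kCoeff a 0 / ramanujanR a := by
    rw [le_div_iff₀ (ramanujanR_pos ha ha1)]
    linarith
  linarith

theorem le_of_forall_kSeries_lt {a β : ℝ} (ha : 0 < a) (ha1 : a < 1)
    (h : ∀ z : ℝ, 0 < z → z < 1 →
      kSeries a z < (ramanujanR a - log (1 - z)) * (1 + β * (1 - z))) :
    a * (1 - a) ≤ β := by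
  by_contra! hβ
  obtain ⟨C, hC⟩ := exists_le_kSeries ha ha1
  have hd : 0 < a * (1 - a) - β := by linarith
  -- At `z = 1 - exp (-T)` one has `-log (1 - z) = T`; this `T` makes `(a(1-a) - β)(R + T)` exceed
  -- `C`.
  set T := max 1 (C / (a * (1 - a) - β))
  have hT : 1 ≤ T := le_max_left _ _
  have hT2 : C ≤ T * (a * (1 - a) - β) := (div_le_iff₀ hd).1 (le_max_right _ _)
  have hx0 := Real.exp_pos (-T)
  have hx1 : Real.exp (-T) < 1 := Real.exp_lt_one_iff.2 (by linarith)
  have h1 := h (1 - Real.exp (-T)) (by linarith) (by linarith)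
  have h2 := hC (1 - Real.exp (-T)) (by linarith) (by linarith)
  rw [sub_sub_cancel, Real.log_exp] at h1 h2
  have hR := ramanujanR_pos ha ha1
  have h3 : 0 < Real.exp (-T) * ((a * (1 - a) - β) * (ramanujanR a + T) - C) :=
    mul_pos hx0 (by nlinarith [mul_pos hd hR])
  linarith

theorem theorem1p1 (a : ℝ) (ha : a ∈ Set.Ioc (0 : ℝ) (1 / 2)) (α β : ℝ) :
    (∀ r ∈ Set.Ioo (0 : ℝ) 1,
      1 + α * √(1 - r ^ 2) ^ 2 <
          ellipticKGen a r /
            (Real.sin (π * a) * Real.log (Real.exp (ramanujanR a / 2) / √(1 - r ^ 2))) ∧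
        ellipticKGen a r /
            (Real.sin (π * a) * Real.log (Real.exp (ramanujanR a / 2) / √(1 - r ^ 2))) <
          1 + β * √(1 - r ^ 2) ^ 2) ↔
      α ≤ π / (ramanujanR a * Real.sin (π * a)) - 1 ∧ a * (1 - a) ≤ β := by
  have ha0 : 0 < a := ha.1
  have ha1 : a < 1 := by linarith [ha.2]
  have hm : π / (ramanujanR a * Real.sin (π * a)) - 1 = kCoeff a 0 / ramanujanR a - 1 := by
    rw [kCoeff_zero, Real.Gamma_mul_Gamma_one_sub, div_div, mul_comm (ramanujanR a)]
  rw [hm]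
  have hiff : ∀ r ∈ Set.Ioo (0 : ℝ) 1, (1 + α * √(1 - r ^ 2) ^ 2 <
          ellipticKGen a r /
            (Real.sin (π * a) * Real.log (Real.exp (ramanujanR a / 2) / √(1 - r ^ 2))) ∧
        ellipticKGen a r /
            (Real.sin (π * a) * Real.log (Real.exp (ramanujanR a / 2) / √(1 - r ^ 2))) <
          1 + β * √(1 - r ^ 2) ^ 2) ↔
      ((ramanujanR a - log (1 - r ^ 2)) * (1 + α * (1 - r ^ 2)) < kSeries a (r ^ 2) ∧
        kSeries a (r ^ 2) < (ramanujanR a - log (1 - r ^ 2)) * (1 + β * (1 - r ^ 2))) := by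
    intro r hr
    have hx : 0 < 1 - r ^ 2 := by nlinarith [hr.1, hr.2]
    have hD := ramanujanR_sub_log_pos ha0 ha1 (pow_pos hr.1 2) (by linarith)
    rw [ellipticKGen_ratio_eq ha0 ha1 hr, Real.sq_sqrt hx.le, lt_div_iff₀ hD, div_lt_iff₀ hD,
      mul_comm (1 + α * _), mul_comm (1 + β * _)]
  constructor
  · intro h
    have hz : ∀ z : ℝ, 0 < z → z < 1 →
        (ramanujanR a - log (1 - z)) * (1 + α * (1 - z)) < kSeries a z ∧
          kSeries a z < (ramanujanR a - log (1 - z)) * (1 + β * (1 - z)) := by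
      intro z hz0 hz1
      have hr : √z ∈ Set.Ioo (0 : ℝ) 1 :=
        ⟨Real.sqrt_pos.2 hz0, (Real.sqrt_lt' one_pos).2 (by simpa using hz1)⟩
      have := (hiff _ hr).1 (h _ hr)
      rwa [Real.sq_sqrt hz0.le] at this
    exact ⟨le_of_forall_lt_kSeries ha0 ha1 fun z h0 h1 ↦ (hz z h0 h1).1,
      le_of_forall_kSeries_lt ha0 ha1 fun z h0 h1 ↦ (hz z h0 h1).2⟩
  · rintro ⟨hα, hβ⟩ r hr
    rw [hiff r hr]
    have hx : 0 < 1 - r ^ 2 := by nlinarith [hr.1, hr.2]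
    have hz0 : 0 < r ^ 2 := pow_pos hr.1 2
    have hD := ramanujanR_sub_log_pos ha0 ha1 hz0 (by linarith)
    refine ⟨lt_of_le_of_lt ?_ (lt_kSeries ha0 ha1 hz0 (by linarith)),
      lt_of_lt_of_le (kSeries_lt ha0 ha1 hz0 (by linarith)) ?_⟩ <;> gcongr
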